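/- Let $V$ be a Euclidean space, i.e. a finite-dimensional real inner product space, and let $C(V)$ be its Clifford algebra, the quotient of the tensor algebra $T(V)$ by the two-sided ideal generated by the elements $v\otimes v+|v|^2$, $v\in V$. Let $\alpha$ be the algebra involution of $C(V)$ with $\alpha(v)=-v$ for $v\in V$, let $t$ be the anti-involution with $t(v)=v$ for $v\in V$, and put $N(x)=x\,t(\alpha(x))$. Let $\Gamma_V=\{x\in C(V)^\times : \alpha(x)Vx^{-1}=V\}$ and $\mathrm{Pin}(V)=\{x\in\Gamma_V : N(x)=1\}$, and let $\rho:\mathrm{Pin}(V)\to \mathrm{O}(V)$ be the homomorphism $\rho(x)v=\alpha(x)vx^{-1}$. A real representation of a finite group $G$ is a homomorphism $\pi:G\to \mathrm{O}(V)$ for some such $V$ (every finite-dimensional real representation can be conjugated into this form), and $\chi_\pi(g)=\operatorname{tr}\pi(g)$ is its character. A lift of $\pi$ is a homomorphism $\hat\pi:G\to\mathrm{Pin}(V)$ with $\rho\circ\hat\pi=\pi$, and $\pi$ is called spinorial if it has a lift. **Theorem.** Let $n\ge 4$, and write $s_i\in S_n$ for the transposition $(i,i+1)$. 1. A real representation $\pi$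 of $S_n$ is spinorial if and only if $$\chi_\pi(1)\equiv\chi_\pi(s_1s_3) \pmod 8 \quad\text{and}\quad \chi_\pi(1)-\chi_\pi(s_1)\equiv 0 \text{ or } 6 \pmod 8.$$ A spinorial representation $\pi$ of $S_n$ has exactly two lifts. 2. A real representation $\pi$ of the alternating group $A_n$ is spinorial if and only if $$\chi_\pi(1)\equiv\chi_\pi(s_1s_3)\pmod 8.$$ A spinorial representation $\pi$ of $A_n$ has exactly one lift. -/

import Mathlib

/-! ### The Pin group of a Euclidean space

Throughout `V` is a real inner product space. The Clifford algebra is taken with the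
convention `v * v = -|v|²`. In Mathlib, `CliffordAlgebra.involute` is the involution `α` with
`α v = -v`, `CliffordAlgebra.reverse` is the anti-involution `t` with `t v = v`, and
`star x = t (α x)`. -/

namespace PinLift

section PinGroup

variable (V : Type*) [NormedAddCommGroup V] [InnerProductSpace ℝ V]

/-- The quadratic form `v ↦ -|v|²`. -/
noncomputable def negNormSq : QuadraticForm ℝ V :=
  -LinearMap.BilinMap.toQuadraticMap (innerₗ V)

theorem negNormSq_apply (v : V) : negNormSq V v = -‖v‖ ^ 2 := by
  simp [negNormSq]

/-- The Clifford algebra `C(V)`: the tensor algebra modulo the relations `v ⊗ v = -|v|²`. -/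
abbrev Cl : Type _ := CliffordAlgebra (negNormSq V)

/-- The canonical inclusion `V → C(V)`. -/
noncomputable abbrev vec : V →ₗ[ℝ] Cl V := CliffordAlgebra.ι (negNormSq V)

theorem vec_injective : Function.Injective (vec V) := by
  intro v w h
  have h' := congrArg (CliffordAlgebra.changeForm (Q' := 0)
    CliffordAlgebra.changeForm.associated_neg_proof) h
  rw [CliffordAlgebra.changeForm_ι, CliffordAlgebra.changeForm_ι] at h'
  exact (ExteriorAlgebra.ι_leftInverse (R := ℝ) (M := V)).injective h'

variable {V}

/-- The twisted conjugation `y ↦ α(x) y x⁻¹` of `C(V)` by a unit `x`. -/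
noncomputable def twistedConj : (Cl V)ˣ →* Module.End ℝ (Cl V) where
  toFun x := LinearMap.mulLeft ℝ (CliffordAlgebra.involute (x : Cl V)) ∘ₗ
    LinearMap.mulRight ℝ ((x⁻¹ : (Cl V)ˣ) : Cl V)
  map_one' := by ext; simp
  map_mul' x y := by
    apply LinearMap.ext
    intro z
    simp [mul_assoc]

theorem twistedConj_apply (x : (Cl V)ˣ) (y : Cl V) :
    twistedConj x y = CliffordAlgebra.involute (x : Cl V) * y * ((x⁻¹ : (Cl V)ˣ) : Cl V) := by
  simp [twistedConj, mul_assoc]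

variable (V) in
/-- The group `Γ_V` of all units `x` of `C(V)` with `α(x) V x⁻¹ = V`. -/
noncomputable def cliffordGroup : Subgroup (Cl V)ˣ where
  carrier := {x | (LinearMap.range (vec V)).map (twistedConj x) = LinearMap.range (vec V)}
  one_mem' := by
    simp only [Set.mem_ofPred_eq, map_one]
    exact Submodule.map_id _
  mul_mem' {x y} hx hy := by
    simp only [Set.mem_ofPred_eq] at hx hy ⊢
    rw [map_mul, Module.End.mul_eq_comp, Submodule.map_comp, hy, hx]
  inv_mem' {x} hx := by
    simp only [Set.mem_ofPred_eq] at hx ⊢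
    conv_lhs => rw [← hx]
    rw [← Submodule.map_comp, ← Module.End.mul_eq_comp, ← map_mul, inv_mul_cancel, map_one]
    exact Submodule.map_id _

theorem mem_cliffordGroup_iff {x : (Cl V)ˣ} : x ∈ cliffordGroup V ↔
    (LinearMap.range (vec V)).map (twistedConj x) = LinearMap.range (vec V) := Iff.rfl

variable (V) in
/-- `Pin(V)`: the elements `x` of `Γ_V` with `N(x) = x * t (α x) = 1`. -/
noncomputable def Pin : Subgroup (Cl V)ˣ where
  carrier := {x | x ∈ cliffordGroup V ∧ (x : Cl V) * star (x : Cl V) = 1}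
  one_mem' := ⟨one_mem _, by simp⟩
  mul_mem' {x y} hx hy := by
    refine ⟨mul_mem hx.1 hy.1, ?_⟩
    rw [Units.val_mul, star_mul, mul_assoc, ← mul_assoc (y : Cl V), hy.2, one_mul, hx.2]
  inv_mem' {x} hx := by
    refine ⟨inv_mem hx.1, ?_⟩
    have h : star (x : Cl V) = ((x⁻¹ : (Cl V)ˣ) : Cl V) :=
      (Units.inv_eq_of_mul_eq_one_right hx.2).symm
    rw [← h, star_star, h, Units.inv_mul]

theorem mem_Pin_iff {x : (Cl V)ˣ} :
    x ∈ Pin V ↔ x ∈ cliffordGroup V ∧ (x : Cl V) * star (x : Cl V) = 1 := Iff.rfl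

theorem twistedConj_vec_mem (x : cliffordGroup V) (v : V) :
    twistedConj (x : (Cl V)ˣ) (vec V v) ∈ LinearMap.range (vec V) := by
  have h := mem_cliffordGroup_iff.mp x.2
  rw [← h]
  exact Submodule.mem_map_of_mem (LinearMap.mem_range_self _ v)

/-- The linear map `v ↦ α(x) v x⁻¹` of `V` attached to `x ∈ Γ_V`. -/
noncomputable def rhoLin (x : cliffordGroup V) : V →ₗ[ℝ] V :=
  (LinearEquiv.ofInjective (vec V) (vec_injective V)).symm.toLinearMap ∘ₗ
    LinearMap.codRestrict (LinearMap.range (vec V)) (twistedConj (x : (Cl V)ˣ) ∘ₗ vec V)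
      (twistedConj_vec_mem x)

theorem vec_rhoLin (x : cliffordGroup V) (v : V) :
    vec V (rhoLin x v) = twistedConj (x : (Cl V)ˣ) (vec V v) := by
  have h := LinearEquiv.ofInjective_apply (vec V) (h := vec_injective V) (rhoLin x v)
  rw [← h]
  simp [rhoLin]

theorem rhoLin_one : rhoLin (1 : cliffordGroup V) = 1 := by
  apply LinearMap.ext
  intro v
  apply vec_injective V
  rw [vec_rhoLin]
  simp

theorem rhoLin_mul (x y : cliffordGroup V) : rhoLin (x * y) = rhoLin x * rhoLin y := by
  apply LinearMap.ext
  intro v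
  apply vec_injective V
  simp [vec_rhoLin]

theorem norm_rhoLin {x : (Cl V)ˣ} (hx : x ∈ Pin V) (v : V) :
    ‖rhoLin ⟨x, hx.1⟩ v‖ = ‖v‖ := by
  have key : ∀ w : V, vec V w * star (vec V w) = algebraMap ℝ (Cl V) (‖w‖ ^ 2) := by
    intro w
    rw [CliffordAlgebra.star_ι, mul_neg, CliffordAlgebra.ι_sq_scalar, negNormSq_apply,
      map_neg, neg_neg]
  have hinv : ((x⁻¹ : (Cl V)ˣ) : Cl V) = star (x : Cl V) := Units.inv_eq_of_mul_eq_one_right hx.2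
  have hα : CliffordAlgebra.involute (x : Cl V) * star (CliffordAlgebra.involute (x : Cl V))
      = 1 := by
    have h := congrArg CliffordAlgebra.involute hx.2
    rw [map_mul, map_one, CliffordAlgebra.star_def'] at h
    rw [CliffordAlgebra.star_def, CliffordAlgebra.involute_involute]
    rwa [CliffordAlgebra.involute_involute] at h
  have h2 : algebraMap ℝ (Cl V) (‖rhoLin ⟨x, hx.1⟩ v‖ ^ 2) = algebraMap ℝ (Cl V) (‖v‖ ^ 2) := by
    rw [← key, vec_rhoLin, twistedConj_apply, star_mul, star_mul, hinv, star_star]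
    have hs : star (x : Cl V) * (x : Cl V) = 1 := by rw [← hinv, Units.inv_mul]
    calc _ = CliffordAlgebra.involute (x : Cl V) * vec V v * (star (x : Cl V) * (x : Cl V)) *
          (star (vec V v) * star (CliffordAlgebra.involute (x : Cl V))) := by
          simp only [mul_assoc]
      _ = CliffordAlgebra.involute (x : Cl V) * (vec V v * star (vec V v)) *
          star (CliffordAlgebra.involute (x : Cl V)) := by
          rw [hs, mul_one]; simp only [mul_assoc]
      _ = algebraMap ℝ (Cl V) (‖v‖ ^ 2) * (CliffordAlgebra.involute (x : Cl V) *
          star (CliffordAlgebra.involute (x : Cl V))) := by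
          rw [key, ← Algebra.commutes, mul_assoc]
      _ = _ := by rw [hα, mul_one]
  have h3 := (algebraMap ℝ (Cl V)).injective h2
  exact (sq_eq_sq₀ (norm_nonneg _) (norm_nonneg _)).mp h3

variable (V) in
/-- The homomorphism `ρ : Pin(V) → O(V)`, `ρ(x) v = α(x) v x⁻¹`. Here `O(V)` is the group
`V ≃ₗᵢ[ℝ] V` of linear isometries of `V`. -/
noncomputable def rho : Pin V →* (V ≃ₗᵢ[ℝ] V) where
  toFun x :=
    { toLinearEquiv := LinearEquiv.ofLinearMap
        (rhoLin ⟨(x : (Cl V)ˣ), x.2.1⟩) (rhoLin ⟨((x⁻¹ : Pin V) : (Cl V)ˣ), (x⁻¹).2.1⟩)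
        (by
          rw [← Module.End.mul_eq_comp, ← rhoLin_mul, ← Module.End.one_eq_id, ← rhoLin_one]
          congr 1
          ext
          simp)
        (by
          rw [← Module.End.mul_eq_comp, ← rhoLin_mul, ← Module.End.one_eq_id, ← rhoLin_one]
          congr 1
          ext
          simp)
      norm_map' := norm_rhoLin x.2 }
  map_one' := by
    ext v
    exact congrArg (fun f : V →ₗ[ℝ] V => f v) rhoLin_one
  map_mul' x y := by
    ext v
    exact congrArg (fun f : V →ₗ[ℝ] V => f v)
      (rhoLin_mul ⟨(x : (Cl V)ˣ), x.2.1⟩ ⟨(y : (Cl V)ˣ), y.2.1⟩)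

/-- The defining property of `ρ`: inside `C(V)` one has `ρ(x) v = α(x) v x⁻¹`. -/
theorem vec_rho (x : Pin V) (v : V) :
    vec V (rho V x v) = CliffordAlgebra.involute ((x : (Cl V)ˣ) : Cl V) * vec V v *
      (((x : (Cl V)ˣ)⁻¹ : (Cl V)ˣ) : Cl V) := by
  rw [← twistedConj_apply]
  exact vec_rhoLin _ v

end PinGroup

section Representations

variable {G : Type*} [Group G] {V : Type*} [NormedAddCommGroup V] [InnerProductSpace ℝ V]

/-- The lifts of an orthogonal representation `π : G → O(V)`: the homomorphisms
`π' : G → Pin(V)` with `ρ ∘ π' = π`. -/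
def lifts (π : G →* (V ≃ₗᵢ[ℝ] V)) : Set (G →* Pin V) :=
  {π' | (rho V).comp π' = π}

/-- An orthogonal representation is spinorial if it lifts to `Pin(V)`. -/
def IsSpinorial (π : G →* (V ≃ₗᵢ[ℝ] V)) : Prop :=
  ∃ π' : G →* Pin V, (rho V).comp π' = π

/-- The character `χ_π(g) = tr π(g)`. -/
noncomputable def character (π : G →* (V ≃ₗᵢ[ℝ] V)) (g : G) : ℝ :=
  LinearMap.trace ℝ V (π g).toLinearEquiv.toLinearMap

end Representations

section SymmetricGroup

/-- The transposition `s_i = (i, i + 1)`, `1 ≤ i ≤ n - 1`, in `S_n`. As `Fin n` is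
`{0, …, n - 1}`, the letters `i` and `i + 1` are the elements `i - 1` and `i` of `Fin n`. -/
def s {n : ℕ} (i : ℕ) (_h1 : 1 ≤ i) (h2 : i < n) : Equiv.Perm (Fin n) :=
  Equiv.swap ⟨i - 1, by omega⟩ ⟨i, h2⟩

/-- The element `s_1` of `S_n`, `n ≥ 4`. -/
def s₁ {n : ℕ} (hn : 4 ≤ n) : Equiv.Perm (Fin n) := s 1 (by omega) (by omega)

/-- The element `s_1 s_3` of `S_n`, `n ≥ 4`. -/
def s₁s₃ {n : ℕ} (hn : 4 ≤ n) : Equiv.Perm (Fin n) :=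
  s 1 (by omega) (by omega) * s 3 (by omega) (by omega)

theorem s₁s₃_mem {n : ℕ} (hn : 4 ≤ n) : s₁s₃ hn ∈ alternatingGroup (Fin n) := by
  simp only [Equiv.Perm.mem_alternatingGroup, s₁s₃, s, map_mul]
  rw [Equiv.Perm.sign_swap (by simp), Equiv.Perm.sign_swap (by simp)]
  simp

end SymmetricGroup

end PinLift

/-! The map `rho V` is onto with kernel `{1, -1}`. If `g` is an orthogonal involution with
`-1`-eigenspace of dimension `m`, its lifts are `±e₁⋯eₘ` for an orthonormal basis of that
eigenspace. They square to `(-1)^(m(m+1)/2)`, so they are involutions exactly when `m` is `0` or `3`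
mod `4`. As `2m = χ(1) - χ(g)`, the congruences say that the images of `s₁s₃` and `s₁` have
involutive lifts. For alternating groups the determinant is trivial, so `m` is even and only `0` mod
`4` survives. Necessity is then immediate.

For sufficiency on `A_n`, take Carmichael's generators `vᵢ = (a i)(a b)`. An element whose cube is
`1` has exactly one lift `xᵢ` with cube `1`, and `vᵢvⱼ` is a double transposition, so the `xᵢ`
inherit the relations `vᵢ³ = (vᵢvⱼ)² = 1`. Coset enumeration bounds the group generated by the pairs
`(xᵢ, vᵢ)` by `n!/2`. It surjects onto `A_n`, hence is the graph of a lift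
(`isSpinorial_of_lift_sq_eq_one`). That lift is unique because 3-cycles generate.

For `S_n`, uniqueness makes the lift on `A_n` compatible with conjugation by an involutive lift `c`
of a transposition, so it extends (`perm_exists_lift`). The choice between `c` and `-c` gives the
two lifts. -/

namespace PinLift

/-! ### Clifford relations and the twisted centralizer of `V`. -/

section CliffordRelations

variable {V : Type*} [NormedAddCommGroup V] [InnerProductSpace ℝ V]

theorem vec_mul_self (v : V) : vec V v * vec V v = algebraMap ℝ (Cl V) (-‖v‖ ^ 2) := by
  rw [CliffordAlgebra.ι_sq_scalar, negNormSq_apply]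

theorem vec_mul_vec_add_swap (v w : V) :
    vec V v * vec V w + vec V w * vec V v = algebraMap ℝ (Cl V) (-(2 * inner ℝ v w)) := by
  rw [CliffordAlgebra.ι_mul_ι_add_swap, QuadraticMap.polar, negNormSq_apply, negNormSq_apply,
    negNormSq_apply, norm_add_sq_real]
  congr 1
  ring

theorem vec_mul_self_of_norm_eq_one {v : V} (hv : ‖v‖ = 1) : vec V v * vec V v = -1 := by
  rw [vec_mul_self, hv]
  simp

theorem vec_mul_vec_of_inner_eq_zero {v w : V} (h : inner ℝ v w = 0) :
    vec V v * vec V w = -(vec V w * vec V v) := by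
  rw [eq_neg_iff_add_eq_zero, vec_mul_vec_add_swap, h]
  simp

/-- The subalgebra of `C(V)` generated by a set of vectors of an orthonormal basis. -/
noncomputable def subCl {ι : Type*} [Fintype ι] (b : OrthonormalBasis ι ℝ V) (s : Set ι) :
    Subalgebra ℝ (Cl V) :=
  Algebra.adjoin ℝ ((fun i => vec V (b i)) '' s)

variable {ι : Type*} [Fintype ι] (b : OrthonormalBasis ι ℝ V)

theorem vec_mem_subCl {s : Set ι} {i : ι} (hi : i ∈ s) : vec V (b i) ∈ subCl b s :=
  Algebra.subset_adjoin ⟨i, hi, rfl⟩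

theorem vec_basis_mul_self (i : ι) : vec V (b i) * vec V (b i) = -1 :=
  vec_mul_self_of_norm_eq_one (b.norm_eq_one i)

theorem vec_basis_anticomm {i j : ι} (h : i ≠ j) :
    vec V (b i) * vec V (b j) = -(vec V (b j) * vec V (b i)) :=
  vec_mul_vec_of_inner_eq_zero (b.inner_eq_zero h)

theorem involute_mem_subCl {s : Set ι} {p : Cl V} (hp : p ∈ subCl b s) :
    CliffordAlgebra.involute p ∈ subCl b s := by
  induction hp using Algebra.adjoin_induction with
  | mem x hx =>
    obtain ⟨i, hi, rfl⟩ := hx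
    simpa using vec_mem_subCl b hi
  | algebraMap r =>
    rw [AlgHom.commutes]
    exact (subCl b s).algebraMap_mem r
  | add x y _ _ hx hy => simpa using add_mem hx hy
  | mul x y _ _ hx hy => simpa using mul_mem hx hy

/-- Passing `b i` across each other basis vector costs a sign, and `involute` records the product of
these signs. -/
theorem vec_mul_of_mem_subCl {s : Set ι} {i : ι} (hi : i ∉ s) {p : Cl V} (hp : p ∈ subCl b s) :
    vec V (b i) * p = CliffordAlgebra.involute p * vec V (b i) := by
  induction hp using Algebra.adjoin_induction with
  | mem x hx =>
    obtain ⟨j, hj, rfl⟩ := hx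
    have hij : i ≠ j := fun h => hi (h ▸ hj)
    simp only [CliffordAlgebra.involute_ι, neg_mul]
    exact vec_basis_anticomm b hij
  | algebraMap r => simpa using (Algebra.commutes r _).symm
  | add x y _ _ hx hy => rw [mul_add, hx, hy, map_add, add_mul]
  | mul x y _ _ hx hy => rw [← mul_assoc, hx, mul_assoc, hy, map_mul, mul_assoc]

theorem exists_decomp_of_mem_subCl_insert {s : Set ι} {i : ι} (hi : i ∉ s) {x : Cl V}
    (hx : x ∈ subCl b (insert i s)) :
    ∃ p ∈ subCl b s, ∃ q ∈ subCl b s, x = p + vec V (b i) * q := by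
  induction hx using Algebra.adjoin_induction with
  | mem x hx =>
    obtain ⟨j, hj, rfl⟩ := hx
    rcases hj with rfl | hj
    · exact ⟨0, zero_mem _, 1, one_mem _, by simp⟩
    · exact ⟨_, vec_mem_subCl b hj, 0, zero_mem _, by simp⟩
  | algebraMap r => exact ⟨_, (subCl b s).algebraMap_mem r, 0, zero_mem _, by simp⟩
  | add x y _ _ hx hy =>
    obtain ⟨p, hp, q, hq, rfl⟩ := hx
    obtain ⟨p', hp', q', hq', rfl⟩ := hy
    exact ⟨p + p', add_mem hp hp', q + q', add_mem hq hq', by rw [mul_add]; abel⟩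
  | mul x y _ _ hx hy =>
    obtain ⟨p, hp, q, hq, rfl⟩ := hx
    obtain ⟨p', hp', q', hq', rfl⟩ := hy
    have hpe : p * vec V (b i) = vec V (b i) * CliffordAlgebra.involute p := by
      rw [vec_mul_of_mem_subCl b hi (involute_mem_subCl b hp), CliffordAlgebra.involute_involute]
    have hqe : q * vec V (b i) = vec V (b i) * CliffordAlgebra.involute q := by
      rw [vec_mul_of_mem_subCl b hi (involute_mem_subCl b hq), CliffordAlgebra.involute_involute]
    refine ⟨p * p' - CliffordAlgebra.involute q * q',
      sub_mem (mul_mem hp hp') (mul_mem (involute_mem_subCl b hq) hq'),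
      CliffordAlgebra.involute p * q' + q * p',
      add_mem (mul_mem (involute_mem_subCl b hp) hq') (mul_mem hq hp'), ?_⟩
    have h1 : p * (vec V (b i) * q') = vec V (b i) * (CliffordAlgebra.involute p * q') := by
      rw [← mul_assoc, hpe, mul_assoc]
    have h2 : vec V (b i) * q * (vec V (b i) * q') = -(CliffordAlgebra.involute q * q') := by
      calc _ = vec V (b i) * (q * vec V (b i)) * q' := by simp only [mul_assoc]
        _ = vec V (b i) * vec V (b i) * (CliffordAlgebra.involute q * q') := by
          rw [hqe]; simp only [mul_assoc]
        _ = _ := by rw [vec_basis_mul_self]; simp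
    rw [add_mul, mul_add, mul_add, h1, h2, mul_add, mul_assoc]
    abel

/-- Write `x = p + e q` with `e = b i`. The terms in `p` agree on both sides of `h`, and those in
`q` leave `q = -q`. No basis of the Clifford algebra is needed. -/
theorem mem_subCl_of_insert {s : Set ι} {i : ι} (hi : i ∉ s) {x : Cl V}
    (hx : x ∈ subCl b (insert i s))
    (h : CliffordAlgebra.involute x * vec V (b i) = vec V (b i) * x) : x ∈ subCl b s := by
  obtain ⟨p, hp, q, hq, rfl⟩ := exists_decomp_of_mem_subCl_insert b hi hx
  have h1 : CliffordAlgebra.involute (vec V (b i) * q) * vec V (b i) = q := by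
    rw [map_mul, CliffordAlgebra.involute_ι, mul_assoc, ← vec_mul_of_mem_subCl b hi hq,
      ← mul_assoc, neg_mul, vec_basis_mul_self]
    simp
  have h2 : vec V (b i) * (vec V (b i) * q) = -q := by
    rw [← mul_assoc, vec_basis_mul_self]
    simp
  rw [map_add, add_mul, h1, mul_add, h2, vec_mul_of_mem_subCl b hi hp] at h
  have h3 : q = -q := add_left_cancel h
  have h4 : q = 0 := by
    have : (2 : ℝ) • q = 0 := by
      rw [two_smul]
      nth_rewrite 1 [h3]
      simp
    exact (smul_eq_zero.mp this).resolve_left two_ne_zero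
  rw [h4, mul_zero, add_zero]
  exact hp

theorem subCl_univ : subCl b Set.univ = ⊤ := by
  rw [eq_top_iff, ← CliffordAlgebra.adjoin_range_ι, Algebra.adjoin_le_iff]
  rintro _ ⟨v, rfl⟩
  rw [← b.sum_repr v, map_sum]
  refine sum_mem fun i _ => ?_
  rw [map_smul]
  exact Subalgebra.smul_mem _ (vec_mem_subCl b (Set.mem_univ i)) _

/-- The scalars are the only elements that twisted-commute with all vectors. -/
theorem exists_algebraMap_eq_of_twisted_commute [FiniteDimensional ℝ V] {x : Cl V}
    (h : ∀ v : V, CliffordAlgebra.involute x * vec V v = vec V v * x) :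
    ∃ r : ℝ, algebraMap ℝ (Cl V) r = x := by
  classical
  set b := stdOrthonormalBasis ℝ V
  -- Basis vectors are removed one at a time until only scalars remain.
  have key : ∀ s : Finset (Fin (Module.finrank ℝ V)), x ∈ subCl b (s : Set _) →
      x ∈ subCl b ∅ := by
    intro s
    induction s using Finset.induction_on with
    | empty => simp
    | insert i s hi ih =>
      intro hx
      rw [Finset.coe_insert] at hx
      exact ih (mem_subCl_of_insert b (by simpa using hi) hx (h _))
  have hx : x ∈ subCl b ∅ := key Finset.univ (by rw [Finset.coe_univ, subCl_univ]; trivial)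
  rw [subCl, Set.image_empty, Algebra.adjoin_empty] at hx
  exact Algebra.mem_bot.mp hx

end CliffordRelations

/-! ### Kernel and image of `rho`. -/

section PinBasics

variable {V : Type*} [NormedAddCommGroup V] [InnerProductSpace ℝ V]

theorem ext_vec_rho {x y : Pin V} (h : ∀ v, vec V (rho V x v) = vec V (rho V y v)) :
    rho V x = rho V y :=
  LinearIsometryEquiv.ext fun v => vec_injective V (h v)

theorem neg_one_mem_Pin : (-1 : (Cl V)ˣ) ∈ Pin V := by
  refine ⟨?_, by simp⟩
  rw [mem_cliffordGroup_iff]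
  have : twistedConj (-1 : (Cl V)ˣ) = 1 := by
    apply LinearMap.ext
    intro y
    rw [twistedConj_apply]
    simp
  rw [this]
  exact Submodule.map_id _

variable (V) in
/-- The central element `-1` of `Pin(V)`. -/
noncomputable def negOne : Pin V := ⟨-1, neg_one_mem_Pin⟩

theorem coe_negOne : ((negOne V : (Cl V)ˣ) : Cl V) = -1 := by simp [negOne]

theorem Pin_ext {x y : Pin V} (h : ((x : (Cl V)ˣ) : Cl V) = ((y : (Cl V)ˣ) : Cl V)) : x = y :=
  Subtype.ext (Units.ext h)

theorem negOne_mul_self : negOne V * negOne V = 1 :=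
  Pin_ext (by simp [negOne])

theorem negOne_mul_comm (x : Pin V) : negOne V * x = x * negOne V :=
  Pin_ext (by simp [negOne])

theorem negOne_ne_one : negOne V ≠ 1 := by
  intro h
  have h' := congrArg (fun x : Pin V => ((x : (Cl V)ˣ) : Cl V)) h
  simp only [coe_negOne, OneMemClass.coe_one, Units.val_one] at h'
  have h2 : algebraMap ℝ (Cl V) (-1) = algebraMap ℝ (Cl V) 1 := by simpa using h'
  have h3 := (algebraMap ℝ (Cl V)).injective h2
  norm_num at h3

theorem rho_negOne : rho V (negOne V) = 1 := by
  rw [← map_one (rho V)]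
  apply ext_vec_rho
  intro v
  rw [vec_rho, vec_rho]
  simp [negOne]

/-- Acting trivially means twisted-commuting with all vectors, so `x` is a scalar `r`, and `N(x) =
1` reads `r² = 1`. -/
theorem eq_one_or_negOne_of_rho_eq_one [FiniteDimensional ℝ V] {x : Pin V} (h : rho V x = 1) :
    x = 1 ∨ x = negOne V := by
  obtain ⟨r, hr⟩ := exists_algebraMap_eq_of_twisted_commute (x := ((x : (Cl V)ˣ) : Cl V)) (by
    intro v
    have h1 := vec_rho x v
    rw [h] at h1
    have h2 := congrArg (· * ((x : (Cl V)ˣ) : Cl V)) h1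
    simpa [mul_assoc] using h2.symm)
  have h2 := x.2.2
  rw [← hr, CliffordAlgebra.star_algebraMap, ← map_mul, ← map_one (algebraMap ℝ (Cl V))] at h2
  have h3 : r * r = 1 := (algebraMap ℝ (Cl V)).injective h2
  rcases mul_self_eq_one_iff.mp h3 with rfl | rfl
  · exact Or.inl (Pin_ext (by rw [← hr]; simp))
  · exact Or.inr (Pin_ext (by rw [← hr, coe_negOne]; simp))

theorem eq_or_eq_negOne_mul_of_rho_eq [FiniteDimensional ℝ V] {x y : Pin V}
    (h : rho V x = rho V y) : x = y ∨ x = negOne V * y := by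
  have h1 : rho V (x * y⁻¹) = 1 := by rw [map_mul, map_inv, h, mul_inv_cancel]
  rcases eq_one_or_negOne_of_rho_eq_one h1 with h2 | h2
  · exact Or.inl (mul_inv_eq_one.mp h2)
  · exact Or.inr (mul_inv_eq_iff_eq_mul.mp h2)

theorem vec_mul_vec_mul_vec {u : V} (hu : ‖u‖ = 1) (v : V) :
    vec V u * vec V v * vec V u = vec V ((ℝ ∙ u)ᗮ.reflection v) := by
  have h1 : vec V v * vec V u = algebraMap ℝ (Cl V) (-(2 * inner ℝ v u)) - vec V u * vec V v := by
    rw [eq_sub_iff_add_eq, vec_mul_vec_add_swap]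
  have h2 : (ℝ ∙ u)ᗮ.reflection v = v - (2 * inner ℝ v u) • u := by
    rw [Submodule.reflection_orthogonal_apply, Submodule.reflection_singleton_apply, hu,
      real_inner_comm]
    simp [two_smul, add_smul, two_mul]
  rw [mul_assoc, h1, mul_sub, ← mul_assoc, vec_mul_self_of_norm_eq_one hu, h2, map_sub, map_smul,
    ← Algebra.commutes, ← Algebra.smul_def, neg_smul]
  simp
  abel

/-- A unit vector as a unit of the Clifford algebra. -/
noncomputable def vecUnit (u : V) (hu : ‖u‖ = 1) : (Cl V)ˣ where
  val := vec V u
  inv := -vec V u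
  val_inv := by rw [mul_neg, vec_mul_self_of_norm_eq_one hu, neg_neg]
  inv_val := by rw [neg_mul, vec_mul_self_of_norm_eq_one hu, neg_neg]

theorem twistedConj_vecUnit (u : V) (hu : ‖u‖ = 1) (v : V) :
    twistedConj (vecUnit u hu) (vec V v) = vec V ((ℝ ∙ u)ᗮ.reflection v) := by
  rw [twistedConj_apply, ← vec_mul_vec_mul_vec hu]
  simp [vecUnit]

theorem vecUnit_mem_Pin (u : V) (hu : ‖u‖ = 1) : vecUnit u hu ∈ Pin V := by
  refine ⟨?_, ?_⟩
  · rw [mem_cliffordGroup_iff]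
    apply le_antisymm
    · rintro _ ⟨_, ⟨v, rfl⟩, rfl⟩
      exact ⟨_, (twistedConj_vecUnit u hu v).symm⟩
    · rintro _ ⟨v, rfl⟩
      refine ⟨_, ⟨(ℝ ∙ u)ᗮ.reflection v, rfl⟩, ?_⟩
      rw [twistedConj_vecUnit, Submodule.reflection_reflection]
  · change vec V u * star (vec V u) = 1
    rw [CliffordAlgebra.star_ι, mul_neg, vec_mul_self_of_norm_eq_one hu, neg_neg]

/-- A unit vector as an element of `Pin(V)`. -/
noncomputable def pinVec (u : V) (hu : ‖u‖ = 1) : Pin V := ⟨vecUnit u hu, vecUnit_mem_Pin u hu⟩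

theorem rho_pinVec (u : V) (hu : ‖u‖ = 1) : rho V (pinVec u hu) = (ℝ ∙ u)ᗮ.reflection := by
  ext v
  apply vec_injective V
  rw [vec_rho, ← twistedConj_apply]
  exact twistedConj_vecUnit u hu v

theorem pinVec_mul_self (u : V) (hu : ‖u‖ = 1) : pinVec u hu * pinVec u hu = negOne V := by
  apply Pin_ext
  rw [coe_negOne]
  exact vec_mul_self_of_norm_eq_one hu

theorem pinVec_anticomm {u v : V} (hu : ‖u‖ = 1) (hv : ‖v‖ = 1) (h : inner ℝ u v = 0) :
    pinVec u hu * pinVec v hv = negOne V * (pinVec v hv * pinVec u hu) := by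
  apply Pin_ext
  have h1 := vec_mul_vec_of_inner_eq_zero h
  simpa [pinVec, vecUnit, negOne] using h1

/-- By Cartan–Dieudonné reflections generate the orthogonal group, and a unit vector lifts its
reflection. -/
theorem rho_surjective [FiniteDimensional ℝ V] : Function.Surjective (rho V) := by
  rw [← MonoidHom.range_eq_top, eq_top_iff, ← LinearIsometryEquiv.reflections_generate,
    Subgroup.closure_le]
  rintro _ ⟨u, rfl⟩
  -- The generating family includes `u = 0`, whose reflection is the identity.
  by_cases hu : u = 0
  · refine ⟨1, ?_⟩
    subst hu
    ext v
    rw [map_one]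
    refine (Submodule.reflection_mem_subspace_eq_self ?_).symm
    simp
  · have hn : ‖(‖u‖⁻¹ • u)‖ = 1 := norm_smul_inv_norm (𝕜 := ℝ) hu
    refine ⟨pinVec _ hn, ?_⟩
    rw [rho_pinVec]
    have : (ℝ ∙ (‖u‖⁻¹ • u)) = ℝ ∙ u :=
      Submodule.span_singleton_smul_eq (IsUnit.mk0 _ (by simpa using hu)) u
    simp only [this]

end PinBasics

end PinLift

namespace PinLift

/-! ### Squares of lifts of orthogonal involutions. -/

section Involutions

variable {V : Type*} [NormedAddCommGroup V] [InnerProductSpace ℝ V]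

theorem negOne_pow_mul_comm (k : ℕ) (x : Pin V) : negOne V ^ k * x = x * negOne V ^ k :=
  (Commute.pow_left (negOne_mul_comm x) k)

theorem negOne_pow_eq_one_iff (k : ℕ) : negOne V ^ k = 1 ↔ Even k := by
  rcases Nat.even_or_odd k with h | h
  · refine iff_of_true ?_ h
    obtain ⟨j, rfl⟩ := h
    rw [← two_mul, pow_mul, sq, negOne_mul_self, one_pow]
  · refine iff_of_false ?_ (Nat.not_even_iff_odd.mpr h)
    obtain ⟨j, rfl⟩ := h
    rw [pow_succ, pow_mul, sq, negOne_mul_self, one_pow, one_mul]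
    exact negOne_ne_one

/-- Two lifts differ by a central sign, so the square can be computed on any one of them. -/
theorem mul_self_eq_of_rho_eq [FiniteDimensional ℝ V] {x y : Pin V} (h : rho V x = rho V y) :
    x * x = y * y := by
  rcases eq_or_eq_negOne_mul_of_rho_eq h with rfl | rfl
  · rfl
  · rw [mul_assoc, ← mul_assoc y, ← negOne_mul_comm y, mul_assoc, ← mul_assoc, negOne_mul_self,
      one_mul]

variable {ι : Type*} [Fintype ι] (b : OrthonormalBasis ι ℝ V)

/-- The product in `Pin(V)` of vectors of an orthonormal basis. -/
noncomputable def basisProd (l : List ι) : Pin V :=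
  (l.map fun i => pinVec (b i) (b.norm_eq_one i)).prod

theorem basisProd_cons (a : ι) (l : List ι) :
    basisProd b (a :: l) = pinVec (b a) (b.norm_eq_one a) * basisProd b l := by
  simp [basisProd]

theorem basisProd_mul_pinVec {a : ι} {l : List ι} (ha : a ∉ l) :
    basisProd b l * pinVec (b a) (b.norm_eq_one a) =
      negOne V ^ l.length * (pinVec (b a) (b.norm_eq_one a) * basisProd b l) := by
  induction l with
  | nil => simp [basisProd]
  | cons c l ih =>
    have hca : c ≠ a := fun h => ha (h ▸ List.mem_cons_self)
    have hal : a ∉ l := fun h => ha (List.mem_cons_of_mem c h)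
    rw [basisProd_cons, mul_assoc, ih hal, List.length_cons, ← mul_assoc, ← negOne_pow_mul_comm,
      mul_assoc, ← mul_assoc (pinVec (b c) _), pinVec_anticomm _ _ (b.inner_eq_zero hca), pow_succ]
    simp only [mul_assoc]

/-- Moving the second copy of the head past the tail gives one sign per tail vector, and squaring
the head gives one more. The exponents add up to a triangular number. -/
theorem basisProd_mul_self {l : List ι} (hl : l.Nodup) :
    basisProd b l * basisProd b l = negOne V ^ (l.length * (l.length + 1) / 2) := by
  induction l with
  | nil => simp [basisProd]
  | cons a l ih =>
    obtain ⟨ha, hl⟩ := List.nodup_cons.mp hl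
    have h1 : basisProd b (a :: l) * basisProd b (a :: l) =
        negOne V ^ (l.length + 1) * (basisProd b l * basisProd b l) := by
      rw [basisProd_cons, mul_assoc, ← mul_assoc (basisProd b l), basisProd_mul_pinVec b ha,
        ← mul_assoc, ← mul_assoc, ← negOne_pow_mul_comm, mul_assoc (negOne V ^ _),
        ← mul_assoc (pinVec _ _), pinVec_mul_self, pow_succ]
      simp only [mul_assoc]
    rw [h1, ih hl, ← pow_add, List.length_cons]
    congr 1
    have : (l.length + 1) * (l.length + 1 + 1) = l.length * (l.length + 1) + (l.length + 1) * 2 := by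
      ring
    rw [this, Nat.add_mul_div_right _ _ two_pos, add_comm]

theorem rho_basisProd_apply [DecidableEq ι] {l : List ι} (hl : l.Nodup) (i : ι) :
    rho V (basisProd b l) (b i) = if i ∈ l then -b i else b i := by
  induction l with
  | nil => simp [basisProd]
  | cons a l ih =>
    obtain ⟨ha, hl⟩ := List.nodup_cons.mp hl
    rw [basisProd_cons, map_mul, LinearIsometryEquiv.coe_mul, Function.comp_apply, ih hl,
      rho_pinVec]
    by_cases hia : i = a
    · subst hia
      simp [ha, Submodule.reflection_orthogonalComplement_singleton_eq_neg]
    · have h : (ℝ ∙ b a)ᗮ.reflection (b i) = b i := by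
        apply Submodule.reflection_mem_subspace_eq_self
        rw [Submodule.mem_orthogonal_singleton_iff_inner_right]
        exact b.inner_eq_zero (Ne.symm hia)
      by_cases hil : i ∈ l <;> simp [hia, hil, h]


theorem exists_orthonormalBasis_of_involution [FiniteDimensional ℝ V] {g : V ≃ₗᵢ[ℝ] V}
    (hg : g * g = 1) :
    ∃ (b : OrthonormalBasis (Fin (Module.finrank ℝ V)) ℝ V)
      (S : Finset (Fin (Module.finrank ℝ V))), ∀ i, g (b i) = if i ∈ S then -b i else b i := by
  classical
  have hgg : ∀ v, g (g v) = v := fun v => congrArg (fun f : V ≃ₗᵢ[ℝ] V => f v) hg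
  -- An isometry equal to its own inverse is self-adjoint, so the spectral theorem applies; its
  -- eigenvalues have absolute value `1`.
  have hT : (g.toLinearEquiv.toLinearMap).IsSymmetric := by
    intro x y
    have h := g.inner_map_map (g x) y
    rw [hgg] at h
    exact h.symm
  set b := hT.eigenvectorBasis rfl
  have hb : ∀ i, g (b i) = hT.eigenvalues rfl i • b i := fun i => hT.apply_eigenvectorBasis rfl i
  refine ⟨b, Finset.univ.filter fun i => g (b i) = -b i, fun i => ?_⟩
  by_cases h : g (b i) = -b i
  · simp [h]
  · have h1 : ‖g (b i)‖ = 1 := by rw [g.norm_map, b.norm_eq_one]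
    rw [hb, norm_smul, b.norm_eq_one, mul_one, Real.norm_eq_abs] at h1
    simp only [Finset.mem_filter_univ, h, if_false]
    rcases (abs_eq zero_le_one).mp h1 with h2 | h2
    · rw [hb, h2, one_smul]
    · rw [hb, h2] at h
      simp at h

/-- The trace, the determinant and the square of a lift of an orthogonal involution, in terms of
the dimension `m` of its `-1`-eigenspace. -/
theorem exists_trace_det_lift_sq_of_involution [FiniteDimensional ℝ V] {g : V ≃ₗᵢ[ℝ] V}
    (hg : g * g = 1) :
    ∃ m : ℕ, LinearMap.trace ℝ V (1 : V ≃ₗᵢ[ℝ] V).toLinearEquiv.toLinearMap -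
        LinearMap.trace ℝ V g.toLinearEquiv.toLinearMap = 2 * m ∧
      LinearMap.det g.toLinearEquiv.toLinearMap = (-1) ^ m ∧
      ∀ x : Pin V, rho V x = g → x * x = negOne V ^ (m * (m + 1) / 2) := by
  obtain ⟨b, S, hS⟩ := exists_orthonormalBasis_of_involution hg
  refine ⟨S.card, ?_, ?_, ?_⟩
  · rw [LinearMap.trace_eq_sum_inner _ b, LinearMap.trace_eq_sum_inner _ b,
      ← Finset.sum_sub_distrib]
    have : ∀ i, inner ℝ (b i) ((1 : V ≃ₗᵢ[ℝ] V).toLinearEquiv.toLinearMap (b i)) -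
        inner ℝ (b i) (g.toLinearEquiv.toLinearMap (b i)) = if i ∈ S then (2 : ℝ) else 0 := by
      intro i
      change inner ℝ (b i) (b i) - inner ℝ (b i) (g (b i)) = _
      rw [hS]
      split_ifs
      · rw [inner_neg_right, real_inner_self_eq_norm_sq, b.norm_eq_one]
        norm_num
      · simp
    simp only [this]
    simp [mul_comm]
  · have : LinearMap.toMatrix b.toBasis b.toBasis g.toLinearEquiv.toLinearMap =
        Matrix.diagonal fun i => if i ∈ S then (-1 : ℝ) else 1 := by
      ext i j
      rw [LinearMap.toMatrix_apply]
      change b.toBasis.repr (g (b.toBasis j)) i = _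
      rw [OrthonormalBasis.coe_toBasis, hS, Matrix.diagonal_apply]
      by_cases hij : i = j
      · subst hij
        rw [if_pos rfl]
        split_ifs <;> simp
      · split_ifs <;> simp [hij]
    rw [← LinearMap.det_toMatrix b.toBasis, this, Matrix.det_diagonal]
    simp
  · intro x hx
    have h : rho V (basisProd b S.toList) = g := by
      apply LinearIsometryEquiv.toLinearEquiv_injective
      apply b.toBasis.ext'
      intro i
      rw [OrthonormalBasis.coe_toBasis]
      change rho V (basisProd b S.toList) (b i) = g (b i)
      rw [rho_basisProd_apply b S.nodup_toList, hS]
      simp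
    rw [mul_self_eq_of_rho_eq (hx.trans h.symm), basisProd_mul_self b S.nodup_toList,
      Finset.length_toList]

end Involutions

end PinLift

namespace PinLift

/-! ### Coset enumeration for Carmichael's relations. -/

section CarmichaelPresentation

open scoped Pointwise

variable {G : Type*} [Group G]

/-- One step of the coset enumeration for Carmichael's presentation of the alternating groups. -/
theorem closure_insert_subset {T : Finset G} {w : G} (hT : ∀ v ∈ T, v * v * v = 1)
    (hw : w * w * w = 1) (hTT : ∀ v ∈ T, ∀ v' ∈ T, v ≠ v' → v * v' * (v * v') = 1)
    (hTw : ∀ v ∈ T, v * w * (v * w) = 1) :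
    (Subgroup.closure (insert w (T : Set G)) : Set G) ⊆
      (Subgroup.closure (T : Set G) : Set G) *
        (({1, w, w⁻¹} : Set G) ∪ (fun v => w⁻¹ * v) '' (T : Set G)) := by
  set H := Subgroup.closure (T : Set G)
  set R : Set G := ({1, w, w⁻¹} : Set G) ∪ (fun v => w⁻¹ * v) '' (T : Set G)
  have hmem : ∀ h ∈ H, ∀ r ∈ R, h * r ∈ (H : Set G) * R := fun h hh r hr => Set.mul_mem_mul hh hr
  have h1R : (1 : G) ∈ R := by simp [R]
  have hwR : w ∈ R := by simp [R]
  have hwR' : w⁻¹ ∈ R := by simp [R]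
  have hvR : ∀ v ∈ T, w⁻¹ * v ∈ R := fun v hv => Or.inr ⟨v, hv, rfl⟩
  have hvH : ∀ v ∈ T, v ∈ H := fun v hv => Subgroup.subset_closure hv
  have hww : w * w = w⁻¹ := eq_inv_of_mul_eq_one_left hw
  have hww' : w⁻¹ * w⁻¹ = w := by rw [← mul_inv_rev, hww, inv_inv]
  have hvv : ∀ v ∈ T, v * v = v⁻¹ := fun v hv => eq_inv_of_mul_eq_one_left (hT v hv)
  have hvv' : ∀ v ∈ T, v⁻¹ * v⁻¹ = v := fun v hv => by rw [← mul_inv_rev, hvv v hv, inv_inv]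
  have hvw : ∀ v ∈ T, v * w = w⁻¹ * v⁻¹ := fun v hv => by
    rw [← mul_inv_rev]
    exact eq_inv_of_mul_eq_one_left (hTw v hv)
  have hwv : ∀ v ∈ T, w * v = v⁻¹ * w⁻¹ := fun v hv => by
    calc w * v = v⁻¹ * (v * w) * v := by group
      _ = v⁻¹ * (w⁻¹ * v⁻¹) * v := by rw [hvw v hv]
      _ = v⁻¹ * w⁻¹ := by group
  have hwv' : ∀ v ∈ T, w⁻¹ * v⁻¹ = v * w := fun v hv => (hvw v hv).symm
  have hwvi : ∀ v ∈ T, w * v⁻¹ = v⁻¹ * (w⁻¹ * v) := fun v hv => by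
    calc w * v⁻¹ = w * v * v := by rw [mul_assoc, hvv v hv]
      _ = v⁻¹ * (w⁻¹ * v) := by rw [hwv v hv, mul_assoc]
  -- The heart of the enumeration: right multiplication by a generator sends each coset `H r`, `r ∈
  -- R`, into another such coset.
  have hright : ∀ x ∈ (H : Set G) * R, ∀ y ∈ insert w (T : Set G), x * y ∈ (H : Set G) * R := by
    rintro _ ⟨h, hh, r, hr, rfl⟩ y hy
    change h * r * y ∈ _
    rw [mul_assoc]
    have hgo : ∀ k ∈ H, ∀ r' ∈ R, r * y = k * r' → h * (r * y) ∈ (H : Set G) * R := by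
      intro k hk r' hr' heq
      rw [heq, ← mul_assoc]
      exact hmem _ (mul_mem hh hk) _ hr'
    have hone := one_mem H
    rcases hy with rfl | hy
    · rcases hr with (rfl | rfl | rfl) | ⟨v, hv, rfl⟩
      · exact hgo 1 hone _ hwR rfl
      · exact hgo 1 hone _ hwR' (by rw [hww, one_mul])
      · exact hgo 1 hone _ h1R (by simp)
      · refine hgo v⁻¹ (inv_mem (hvH v hv)) _ (hvR v hv) ?_
        change y⁻¹ * v * y = _
        rw [mul_assoc, hvw v hv, ← mul_assoc, hww', hwvi v hv]
    · rcases hr with (rfl | rfl | rfl) | ⟨v, hv, rfl⟩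
      · exact hgo y (hvH y hy) _ h1R (by simp)
      · exact hgo y⁻¹ (inv_mem (hvH y hy)) _ hwR' (hwv y hy)
      · exact hgo 1 hone _ (hvR y hy) (by simp)
      · change h * (w⁻¹ * v * y) ∈ _
        by_cases hvy : v = y
        · subst hvy
          exact hgo v (hvH v hv) _ hwR (by
            change w⁻¹ * v * v = _
            rw [mul_assoc, hvv v hv, hwv' v hv])
        -- For `v ≠ y`: `w⁻¹vy = w⁻¹y⁻¹v⁻¹ = ywv⁻¹ = yv⁻¹ · w⁻¹v`.
        · refine hgo (y * v⁻¹) (mul_mem (hvH y hy) (inv_mem (hvH v hv))) _ (hvR v hv) ?_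
          have h1 : v * y = y⁻¹ * v⁻¹ := by
            rw [← mul_inv_rev]
            exact eq_inv_of_mul_eq_one_left (hTT v hv y hy hvy)
          change w⁻¹ * v * y = _
          rw [mul_assoc, h1, ← mul_assoc, hwv' y hy, mul_assoc, hwvi v hv, mul_assoc]
  intro x hx
  induction hx using Subgroup.closure_induction_right with
  | one => simpa using hmem 1 (one_mem H) 1 h1R
  | mul_right x _ y hy hx => exact hright x hx y hy
  | mul_inv_cancel x _ y hy hx =>
    have : y⁻¹ = y * y := by
      rcases hy with rfl | hy
      · exact hww.symm
      · exact (hvv y hy).symm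
    rw [this, ← mul_assoc]
    exact hright _ (hright x hx y hy) y hy

/-- A group generated by a set `T` of elements of order dividing `3`, any two of which have a
product of order dividing `2`, has at most `(|T| + 2)! / 2` elements. -/
theorem finite_and_card_closure_le (T : Finset G) (hT : ∀ v ∈ T, v * v * v = 1)
    (hTT : ∀ v ∈ T, ∀ v' ∈ T, v ≠ v' → v * v' * (v * v') = 1) :
    Finite (Subgroup.closure (T : Set G)) ∧
      2 * Nat.card (Subgroup.closure (T : Set G)) ≤ (T.card + 2).factorial := by
  classical
  induction T using Finset.induction_on with
  | empty =>
    rw [Finset.coe_empty, Subgroup.closure_empty]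
    exact ⟨inferInstance, by simp⟩
  | insert w T hwT ih =>
    obtain ⟨hfin, hcard⟩ := ih (fun v hv => hT v (Finset.mem_insert_of_mem hv))
      (fun v hv v' hv' => hTT v (Finset.mem_insert_of_mem hv) v' (Finset.mem_insert_of_mem hv'))
    have hsub := closure_insert_subset (w := w) (fun v hv => hT v (Finset.mem_insert_of_mem hv))
      (hT w (Finset.mem_insert_self w T))
      (fun v hv v' hv' => hTT v (Finset.mem_insert_of_mem hv) v' (Finset.mem_insert_of_mem hv'))
      (fun v hv => hTT v (Finset.mem_insert_of_mem hv) w (Finset.mem_insert_self w T)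
        (fun h => hwT (h ▸ hv)))
    set H := Subgroup.closure (T : Set G)
    have hR : ((({1, w, w⁻¹} : Finset G) ∪ T.image fun v => w⁻¹ * v : Finset G) : Set G) =
        ({1, w, w⁻¹} : Set G) ∪ (fun v => w⁻¹ * v) '' (T : Set G) := by
      simp only [Finset.coe_union, Finset.coe_insert, Finset.coe_singleton, Finset.coe_image]
    rw [← hR] at hsub
    set R : Finset G := ({1, w, w⁻¹} : Finset G) ∪ T.image fun v => w⁻¹ * v
    -- The number of cosets is exactly the factor by which the factorial bound grows.
    have hRcard : R.card ≤ T.card + 3 := by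
      refine (Finset.card_union_le _ _).trans ?_
      rw [add_comm]
      exact Nat.add_le_add Finset.card_image_le Finset.card_le_three
    have hHR : ((H : Set G) * (R : Set G)).Finite :=
      Set.Finite.mul (Set.toFinite (H : Set G)) R.finite_toSet
    rw [Finset.coe_insert]
    refine ⟨hHR.subset hsub, ?_⟩
    have h1 : Nat.card (Subgroup.closure (insert w (T : Set G))) ≤
        Nat.card ((H : Set G) * (R : Set G) : Set G) := Nat.card_mono hHR hsub
    have h2 : Nat.card ((H : Set G) * (R : Set G) : Set G) ≤ Nat.card H * R.card := by
      refine Set.natCard_mul_le.trans (le_of_eq ?_)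
      simp
    rw [Finset.card_insert_of_notMem hwT, show T.card + 1 + 2 = (T.card + 2) + 1 by ring,
      Nat.factorial_succ]
    calc 2 * Nat.card (Subgroup.closure (insert w (T : Set G)))
        ≤ 2 * (Nat.card H * R.card) := Nat.mul_le_mul_left 2 (h1.trans h2)
      _ = R.card * (2 * Nat.card H) := by ring
      _ ≤ (T.card + 2 + 1) * (T.card + 2).factorial := Nat.mul_le_mul hRcard hcard

end CarmichaelPresentation

/-! ### Generators and double transpositions of the alternating group. -/

section Alternating

open Equiv Equiv.Perm

variable {α : Type*} [Fintype α] [DecidableEq α]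

theorem swap_mul_swap_mem_alternatingGroup (a b i : α) (hi : i ≠ a) (hb : b ≠ a) :
    swap a i * swap a b ∈ alternatingGroup α := by
  rw [mem_alternatingGroup, map_mul, sign_swap hi.symm, sign_swap hb.symm]
  simp

/-- Carmichael's generators `(a i)(a b)` generate the alternating group. -/
theorem closure_swap_mul_swap {a b : α} (hab : a ≠ b) :
    Subgroup.closure ((fun i => swap a i * swap a b) '' {i | i ≠ a ∧ i ≠ b}) =
      alternatingGroup α := by
  set H := Subgroup.closure ((fun i => swap a i * swap a b) '' {i | i ≠ a ∧ i ≠ b})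
  have hle : H ≤ alternatingGroup α := by
    rw [Subgroup.closure_le]
    rintro _ ⟨i, hi, rfl⟩
    exact swap_mul_swap_mem_alternatingGroup a b i hi.1 hab.symm
  have hgen : ∀ i, i ≠ a → swap a i * swap a b ∈ H := by
    intro i hia
    by_cases hib : i = b
    · subst hib
      rw [swap_mul_self]
      exact one_mem H
    · exact Subgroup.subset_closure ⟨i, ⟨hia, hib⟩, rfl⟩
  -- Conjugation by `swap a b` inverts each generator, so it preserves `H`.
  have hconj : ∀ h ∈ H, swap a b * h * swap a b ∈ H := by
    intro h hh
    induction hh using Subgroup.closure_induction with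
    | mem x hx =>
      obtain ⟨i, hi, rfl⟩ := hx
      have : swap a b * (swap a i * swap a b) * swap a b = (swap a i * swap a b)⁻¹ := by
        rw [mul_inv_rev, swap_inv, swap_inv, mul_assoc, mul_assoc, swap_mul_self, mul_one]
      simp only [this]
      exact inv_mem (hgen i hi.1)
    | one => simp [one_mem]
    | mul x y _ _ hx hy =>
      have : swap a b * (x * y) * swap a b =
          (swap a b * x * swap a b) * (swap a b * y * swap a b) := by
        simp only [mul_assoc, swap_mul_self_mul]
      rw [this]
      exact mul_mem hx hy
    | inv x _ hx =>
      have : swap a b * x⁻¹ * swap a b = (swap a b * x * swap a b)⁻¹ := by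
        simp [mul_inv_rev, mul_assoc]
      rw [this]
      exact inv_mem hx
  -- `K = H ∪ H (a b)` contains all transpositions, hence is everything; comparing signs puts the
  -- even permutations in `H`.
  let K : Subgroup (Perm α) :=
    { carrier := {σ | σ ∈ H ∨ σ * swap a b ∈ H}
      one_mem' := Or.inl (one_mem H)
      mul_mem' := by
        rintro x y (hx | hx) (hy | hy)
        · exact Or.inl (mul_mem hx hy)
        · exact Or.inr (by rw [mul_assoc]; exact mul_mem hx hy)
        · refine Or.inr ?_
          have := mul_mem hx (hconj y hy)
          simpa only [mul_assoc, swap_mul_self_mul] using this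
        · refine Or.inl ?_
          have := mul_mem hx (hconj _ hy)
          simpa only [mul_assoc, swap_mul_self_mul, swap_mul_self, mul_one] using this
      inv_mem' := by
        rintro x (hx | hx)
        · exact Or.inl (inv_mem hx)
        · refine Or.inr ?_
          have := hconj _ (inv_mem hx)
          simpa only [mul_inv_rev, swap_inv, mul_assoc, swap_mul_self_mul] using this }
  have hswap_a : ∀ i, swap a i ∈ K := by
    intro i
    by_cases hia : i = a
    · subst hia
      rw [swap_self]
      exact one_mem K
    · exact Or.inr (hgen i hia)
  have hK : K = ⊤ := by
    rw [eq_top_iff, ← closure_isSwap, Subgroup.closure_le]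
    rintro _ ⟨x, y, hxy, rfl⟩
    by_cases hxa : x = a
    · subst hxa; exact hswap_a y
    by_cases hya : y = a
    · subst hya; rw [swap_comm]; exact hswap_a x
    have : swap a x * swap a y * swap a x = swap x y := by
      rw [swap_comm a y]
      exact swap_mul_swap_mul_swap hya hxy.symm
    rw [← this]
    exact mul_mem (mul_mem (hswap_a x) (hswap_a y)) (hswap_a x)
  refine le_antisymm hle fun σ hσ => ?_
  have hσK : σ ∈ K := hK ▸ Subgroup.mem_top σ
  rcases hσK with h | h
  · exact h
  · exfalso
    have h1 := hle h
    rw [mem_alternatingGroup] at h1 hσ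
    rw [map_mul, hσ, sign_swap hab] at h1
    exact absurd h1 (by decide)

theorem swap_mul_swap_cube {a b i : α} (hia : i ≠ a) (hib : i ≠ b) (hab : a ≠ b) :
    (swap a i * swap a b) * (swap a i * swap a b) * (swap a i * swap a b) = 1 := by
  have h := (isThreeCycle_swap_mul_swap_same hia.symm hab hib).orderOf
  rw [← pow_orderOf_eq_one (swap a i * swap a b), h, pow_succ, sq]

omit [Fintype α] in
-- When `i` is also distinct from `a`, `b` and `j`, this exhibits the product of two Carmichael
-- generators as a double transposition.
theorem swap_mul_swap_mul {a b i j : α} (hja : j ≠ a) (hjb : j ≠ b) :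
    (swap a i * swap a b) * (swap a j * swap a b) = swap a i * swap b j := by
  rw [mul_assoc]
  congr 1
  rw [swap_comm a j, ← mul_assoc]
  exact swap_mul_swap_mul_swap hja hjb

/-- Double transpositions are conjugate in the alternating group. -/
theorem exists_conj_swap_mul_swap {x y z t x' y' z' t' : α} (h : [x, y, z, t].Nodup)
    (h' : [x', y', z', t'].Nodup) :
    ∃ σ ∈ alternatingGroup α, σ * (swap x y * swap z t) * σ⁻¹ = swap x' y' * swap z' t' := by
  have hc : IsConj (swap x y * swap z t) (swap x' y' * swap z' t') := by
    rw [isConj_iff_cycleType_eq, cycleType_swap_mul_swap_of_nodup h,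
      cycleType_swap_mul_swap_of_nodup h']
  obtain ⟨σ, hσ⟩ := isConj_iff.mp hc
  rcases Int.units_eq_one_or (sign σ) with hs | hs
  · exact ⟨σ, mem_alternatingGroup.mpr hs, hσ⟩
  -- An odd conjugator is made even by `swap x y`, which centralizes the double transposition.
  · have hxy : x ≠ y := by grind
    refine ⟨σ * swap x y, ?_, ?_⟩
    · rw [mem_alternatingGroup, map_mul, hs, sign_swap hxy]
      simp
    · rw [← hσ]
      have hcomm : swap x y * swap z t = swap z t * swap x y := (disjoint_swap_swap h).commute
      rw [mul_inv_rev, swap_inv]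
      simp only [mul_assoc, swap_mul_self_mul]
      rw [← mul_assoc (swap z t), ← hcomm, mul_assoc]

end Alternating

end PinLift

namespace PinLift

open Equiv Equiv.Perm

/-! ### Homomorphisms on alternating and symmetric groups. -/

section Extension

variable {α : Type*} [Fintype α] [DecidableEq α]

/-- The 3-cycles generate. Only `σ³ = 1` is kept from being a 3-cycle, since this is what pins down
lifts and determinants. -/
theorem alternatingGroup_hom_ext {M : Type*} [Monoid M] {φ ψ : alternatingGroup α →* M}
    (h : ∀ σ : alternatingGroup α, σ * σ * σ = 1 → φ σ = ψ σ) : φ = ψ := by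
  have hle : alternatingGroup α ≤ (φ.eqLocus ψ).map (alternatingGroup α).subtype := by
    refine closure_three_cycles_eq_alternating.ge.trans ((Subgroup.closure_le _).mpr ?_)
    intro σ hσ
    have hσ' : σ.IsThreeCycle := hσ
    refine ⟨⟨σ, hσ'.mem_alternatingGroup⟩, h _ (Subtype.ext ?_), rfl⟩
    have h3 := pow_orderOf_eq_one σ
    rw [hσ'.orderOf, pow_succ, sq] at h3
    exact h3
  ext σ
  obtain ⟨τ, hτ, hτσ⟩ := hle σ.2
  rw [← Subtype.ext hτσ]
  exact hτ

theorem mul_swap_mem_alternatingGroup {a b : α} (hab : a ≠ b) {σ : Perm α}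
    (hσ : σ ∉ alternatingGroup α) : σ * swap a b ∈ alternatingGroup α := by
  rw [mem_alternatingGroup] at hσ ⊢
  rw [map_mul, sign_swap hab, (Int.units_eq_one_or (sign σ)).resolve_left hσ]
  simp

theorem swap_mul_mul_swap_mem_alternatingGroup (a b : α) {σ : Perm α}
    (hσ : σ ∈ alternatingGroup α) : swap a b * σ * swap a b ∈ alternatingGroup α := by
  rw [mem_alternatingGroup] at hσ ⊢
  rw [map_mul, map_mul, hσ, mul_one]
  exact Int.units_mul_self _

theorem perm_hom_ext {M : Type*} [Monoid M] {a b : α} (hab : a ≠ b) {φ ψ : Perm α →* M}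
    (h : φ.comp (alternatingGroup α).subtype = ψ.comp (alternatingGroup α).subtype)
    (hs : φ (swap a b) = ψ (swap a b)) : φ = ψ := by
  have hA : ∀ σ ∈ alternatingGroup α, φ σ = ψ σ := fun σ hσ => DFunLike.congr_fun h ⟨σ, hσ⟩
  ext σ
  by_cases hσ : σ ∈ alternatingGroup α
  · exact hA σ hσ
  · have := hA _ (mul_swap_mem_alternatingGroup hab hσ)
    have h2 : σ = σ * swap a b * swap a b := by rw [mul_assoc, swap_mul_self, mul_one]
    rw [h2, map_mul, map_mul ψ, this, hs]

/-- A homomorphism on the alternating group extends to the symmetric group, with prescribed value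
`c` at a transposition, as soon as `c` is an involution inducing the right conjugation. -/
theorem exists_perm_hom_extending {P : Type*} [Group P] {a b : α} (hab : a ≠ b)
    (φ : alternatingGroup α →* P) (c : P) (hc : c * c = 1)
    (hconj : ∀ h : alternatingGroup α,
      c * φ h * c = φ ⟨swap a b * h * swap a b, swap_mul_mul_swap_mem_alternatingGroup a b h.2⟩) :
    ∃ ψ : Perm α →* P, ψ.comp (alternatingGroup α).subtype = φ ∧ ψ (swap a b) = c := by
  classical
  have hcφ : ∀ h : alternatingGroup α, c * φ h =
      φ ⟨swap a b * h * swap a b, swap_mul_mul_swap_mem_alternatingGroup a b h.2⟩ * c := by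
    intro h
    rw [← hconj, mul_assoc _ c c, hc, mul_one]
  have hodd : ∀ {σ τ : Perm α}, σ ∉ alternatingGroup α → τ ∈ alternatingGroup α →
      σ * τ ∉ alternatingGroup α :=
    fun hσ hτ h => hσ ((Subgroup.mul_mem_cancel_right _ hτ).mp h)
  have hodd' : ∀ {σ τ : Perm α}, σ ∈ alternatingGroup α → τ ∉ alternatingGroup α →
      σ * τ ∉ alternatingGroup α :=
    fun hσ hτ h => hτ ((Subgroup.mul_mem_cancel_left _ hσ).mp h)
  have heven : ∀ {σ τ : Perm α}, σ ∉ alternatingGroup α → τ ∉ alternatingGroup α →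
      σ * τ ∈ alternatingGroup α := by
    intro σ τ hσ hτ
    rw [mem_alternatingGroup] at *
    rw [map_mul, (Int.units_eq_one_or (sign σ)).resolve_left hσ,
      (Int.units_eq_one_or (sign τ)).resolve_left hτ]
    simp
  -- The value on odd `σ = (σ (a b)) (a b)` is forced.
  let f : Perm α → P := fun σ =>
    if h : σ ∈ alternatingGroup α then φ ⟨σ, h⟩
    else φ ⟨σ * swap a b, mul_swap_mem_alternatingGroup hab h⟩ * c
  have hf : ∀ σ (h : σ ∈ alternatingGroup α), f σ = φ ⟨σ, h⟩ := fun σ h => dif_pos h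
  have hf' : ∀ σ (h : σ ∉ alternatingGroup α),
      f σ = φ ⟨σ * swap a b, mul_swap_mem_alternatingGroup hab h⟩ * c := fun σ h => dif_neg h
  let ψ : Perm α →* P := MonoidHom.mk' f (by
    intro σ τ
    by_cases hσ : σ ∈ alternatingGroup α <;> by_cases hτ : τ ∈ alternatingGroup α
    · rw [hf _ (mul_mem hσ hτ), hf _ hσ, hf _ hτ, ← map_mul]
      rfl
    · rw [hf' _ (hodd' hσ hτ), hf _ hσ, hf' _ hτ, ← mul_assoc, ← map_mul]
      congr 2
    · rw [hf' _ (hodd hσ hτ), hf' _ hσ, hf _ hτ, mul_assoc _ c, hcφ, ← mul_assoc, ← map_mul]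
      congr 2
      apply Subtype.ext
      change σ * τ * swap a b = σ * swap a b * (swap a b * τ * swap a b)
      simp only [mul_assoc, swap_mul_self_mul]
    · rw [hf _ (heven hσ hτ), hf' _ hσ, hf' _ hτ, mul_assoc _ c, ← mul_assoc c, hconj, ← map_mul]
      congr 1
      apply Subtype.ext
      change σ * τ = σ * swap a b * (swap a b * (τ * swap a b) * swap a b)
      simp only [mul_assoc, swap_mul_self_mul, swap_mul_self, mul_one])
  refine ⟨ψ, ?_, ?_⟩
  · ext σ
    exact hf _ σ.2
  · have hs : swap a b ∉ alternatingGroup α := by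
      rw [mem_alternatingGroup, sign_swap hab]
      decide
    change f (swap a b) = c
    rw [hf' _ hs]
    have : (⟨swap a b * swap a b, mul_swap_mem_alternatingGroup hab hs⟩ : alternatingGroup α) =
        1 := Subtype.ext (swap_mul_self a b)
    rw [this, map_one, one_mul]

end Extension

/-! ### Existence and uniqueness of lifts over the alternating group. -/

section Lifts

variable {α : Type*} [Fintype α] [DecidableEq α]
  {V : Type*} [NormedAddCommGroup V] [InnerProductSpace ℝ V] [FiniteDimensional ℝ V]

omit [FiniteDimensional ℝ V] in
theorem rho_negOne_mul (x : Pin V) : rho V (negOne V * x) = rho V x := by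
  rw [map_mul, rho_negOne, one_mul]

theorem negOne_mul_cube (x : Pin V) :
    negOne V * x * (negOne V * x) * (negOne V * x) = negOne V * (x * x * x) := by
  have h : negOne V * x * (negOne V * x) = x * x := mul_self_eq_of_rho_eq (rho_negOne_mul x)
  rw [h, ← mul_assoc (x * x), ← negOne_mul_comm (x * x)]
  simp only [mul_assoc]

/-- Any lift has cube `±1`, and changing its sign changes the sign of the cube. -/
theorem exists_lift_cube_eq_one {g : V ≃ₗᵢ[ℝ] V} (hg : g * g * g = 1) :
    ∃ x : Pin V, rho V x = g ∧ x * x * x = 1 := by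
  obtain ⟨x, rfl⟩ := rho_surjective g
  rcases eq_one_or_negOne_of_rho_eq_one (x := x * x * x) (by simpa using hg) with h | h
  · exact ⟨x, rfl, h⟩
  · exact ⟨negOne V * x, rho_negOne_mul x, by rw [negOne_mul_cube, h, negOne_mul_self]⟩

theorem eq_of_rho_eq_of_cube_eq_one {x y : Pin V} (h : rho V x = rho V y) (hx : x * x * x = 1)
    (hy : y * y * y = 1) : x = y := by
  rcases eq_or_eq_negOne_mul_of_rho_eq h with h | rfl
  · exact h
  · rw [negOne_mul_cube, hy, mul_one] at hx
    exact absurd hx negOne_ne_one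

theorem alternatingGroup_lift_unique {π : alternatingGroup α →* (V ≃ₗᵢ[ℝ] V)}
    {φ ψ : alternatingGroup α →* Pin V} (hφ : (rho V).comp φ = π) (hψ : (rho V).comp ψ = π) :
    φ = ψ := by
  refine alternatingGroup_hom_ext fun σ hσ => eq_of_rho_eq_of_cube_eq_one ?_ ?_ ?_
  · exact DFunLike.congr_fun (hφ.trans hψ.symm) σ
  · rw [← map_mul, ← map_mul, hσ, map_one]
  · rw [← map_mul, ← map_mul, hσ, map_one]

omit [FiniteDimensional ℝ V] in
-- Cubing is injective on `ℝ`, so the determinant is `1` on elements with `σ³ = 1`. This later makes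
-- `-1`-eigenspaces of involutions even-dimensional.
theorem alternatingGroup_det_eq_one (π : alternatingGroup α →* (V ≃ₗᵢ[ℝ] V))
    (σ : alternatingGroup α) : LinearMap.det (π σ).toLinearEquiv.toLinearMap = 1 := by
  let d : alternatingGroup α →* ℝ :=
    { toFun := fun σ => LinearMap.det (π σ).toLinearEquiv.toLinearMap
      map_one' := by
        rw [map_one]
        exact LinearMap.det_id
      map_mul' := fun σ τ => by
        rw [map_mul, ← map_mul LinearMap.det]
        rfl }
  have hd : d = 1 := alternatingGroup_hom_ext fun σ hσ => by
    have h : d σ ^ 3 = 1 := by rw [pow_succ, sq, ← map_mul, ← map_mul, hσ, map_one]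
    exact (Odd.strictMono_pow (by decide : Odd 3)).injective (h.trans (one_pow 3).symm)
  exact DFunLike.congr_fun hd σ

/-- An orthogonal representation of an alternating group is spinorial if the lifts of the images
of double transpositions are involutions. -/
theorem isSpinorial_of_lift_sq_eq_one {a b : α} (hab : a ≠ b)
    (π : alternatingGroup α →* (V ≃ₗᵢ[ℝ] V))
    (h : ∀ i j, ∀ hi : i ≠ a ∧ i ≠ b, ∀ hj : j ≠ a ∧ j ≠ b, i ≠ j → ∀ x : Pin V,
      rho V x = π (⟨_, swap_mul_swap_mem_alternatingGroup a b i hi.1 hab.symm⟩ *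
        ⟨_, swap_mul_swap_mem_alternatingGroup a b j hj.1 hab.symm⟩) → x * x = 1) :
    IsSpinorial π := by
  have hx : ∀ i : {i : α // i ≠ a ∧ i ≠ b}, ∃ x : Pin V,
      rho V x = π ⟨_, swap_mul_swap_mem_alternatingGroup a b i i.2.1 hab.symm⟩ ∧
        x * x * x = 1 := by
    intro i
    refine exists_lift_cube_eq_one ?_
    rw [← map_mul, ← map_mul, ← map_one π]
    congr 1
    exact Subtype.ext (swap_mul_swap_cube i.2.1 i.2.2 hab)
  choose x hx hx3 using hx
  classical
  -- Pairing each lift with its permutation makes the subgroup `K` generated by the pairs a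
  -- candidate for the graph of the lift.
  let y : {i : α // i ≠ a ∧ i ≠ b} → Pin V × Perm α := fun i => (x i, swap a i * swap a b)
  let T : Finset (Pin V × Perm α) := Finset.univ.image y
  have hmemT : ∀ v ∈ T, ∃ i, y i = v := fun v hv => by simpa [T] using hv
  obtain ⟨hfin, hcard⟩ := finite_and_card_closure_le T
    (by
      intro v hv
      obtain ⟨i, rfl⟩ := hmemT v hv
      exact Prod.ext (hx3 i) (swap_mul_swap_cube i.2.1 i.2.2 hab))
    (by
      intro v hv v' hv' hne
      obtain ⟨i, rfl⟩ := hmemT v hv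
      obtain ⟨j, rfl⟩ := hmemT v' hv'
      have hij : (i : α) ≠ j := fun h => hne (by rw [Subtype.ext h])
      refine Prod.ext (h i j i.2 j.2 hij _ ?_) ?_
      · rw [map_mul π, Prod.fst_mul, map_mul, hx, hx]
      · change (swap a (i : α) * swap a b) * (swap a (j : α) * swap a b) *
          ((swap a (i : α) * swap a b) * (swap a (j : α) * swap a b)) = 1
        rw [swap_mul_swap_mul j.2.1 j.2.2]
        have hcomm : swap a (i : α) * swap b (j : α) = swap b (j : α) * swap a (i : α) :=
          (disjoint_swap_swap (by
            have := i.2; have := j.2; grind)).commute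
        nth_rewrite 1 [hcomm]
        rw [mul_assoc, swap_mul_self_mul, swap_mul_self])
  set K := Subgroup.closure (T : Set (Pin V × Perm α))
  have hmap : K.map (MonoidHom.snd (Pin V) (Perm α)) = alternatingGroup α := by
    rw [MonoidHom.map_closure, ← closure_swap_mul_swap hab]
    congr 1
    ext σ
    constructor
    · rintro ⟨_, hv, rfl⟩
      obtain ⟨i, rfl⟩ := hmemT _ hv
      exact ⟨i, i.2, rfl⟩
    · rintro ⟨i, hi, rfl⟩
      exact ⟨y ⟨i, hi⟩, Finset.mem_coe.mpr (Finset.mem_image_of_mem y (Finset.mem_univ _)), rfl⟩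
  have hKA : ∀ k : K, (k : Pin V × Perm α).2 ∈ alternatingGroup α := by
    intro k
    rw [← hmap]
    exact ⟨k, k.2, rfl⟩
  let f : K →* alternatingGroup α :=
    ((MonoidHom.snd (Pin V) (Perm α)).comp K.subtype).codRestrict _ hKA
  have hsurj : Function.Surjective f := by
    intro σ
    obtain ⟨k, hk, hkσ⟩ := hmap.ge σ.2
    exact ⟨⟨k, hk⟩, Subtype.ext hkσ⟩
  -- There are at most `|α| - 2` generators, so `2|K| ≤ |α|! = 2|A|`; the surjection `f` is
  -- therefore injective.
  have hle : Nat.card K ≤ Nat.card (alternatingGroup α) := by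
    have hnt : Nontrivial α := ⟨a, b, hab⟩
    have hT : T.card + 2 ≤ Fintype.card α := by
      have h1 : T.card ≤ Fintype.card {i : α // i ≠ a ∧ i ≠ b} := Finset.card_image_le
      have h2 : Fintype.card {i : α // i ≠ a ∧ i ≠ b} = (({a, b} : Finset α)ᶜ).card := by
        rw [Fintype.card_subtype]
        congr 1
        ext i
        simp
      rw [h2, Finset.card_compl, Finset.card_pair hab] at h1
      have h3 : ({a, b} : Finset α).card ≤ Fintype.card α := Finset.card_le_univ _
      rw [Finset.card_pair hab] at h3
      omega
    have h4 := two_mul_nat_card_alternatingGroup (α := α)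
    rw [Nat.card_perm, Nat.card_eq_fintype_card (α := α)] at h4
    have h5 := hcard.trans (Nat.factorial_le hT)
    omega
  have hbij : Function.Bijective f := hsurj.bijective_of_nat_card_le hle
  -- Compatibility with `π` holds on the generating pairs and passes to products and inverses.
  have hrho : ∀ k ∈ K, ∃ hk : k.2 ∈ alternatingGroup α, rho V k.1 = π ⟨k.2, hk⟩ := by
    intro k hk
    induction hk using Subgroup.closure_induction with
    | mem v hv =>
      obtain ⟨i, rfl⟩ := hmemT v hv
      exact ⟨_, hx i⟩
    | one => exact ⟨one_mem _, (map_one (rho V)).trans (map_one π).symm⟩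
    | mul v w _ _ hv hw =>
      obtain ⟨hv, hv'⟩ := hv
      obtain ⟨hw, hw'⟩ := hw
      refine ⟨mul_mem hv hw, ?_⟩
      rw [Prod.fst_mul, map_mul, hv', hw', ← map_mul]
      rfl
    | inv v _ hv =>
      obtain ⟨hv, hv'⟩ := hv
      refine ⟨inv_mem hv, ?_⟩
      rw [Prod.fst_inv, map_inv, hv', ← map_inv]
      rfl
  let e : K ≃* alternatingGroup α := MulEquiv.ofBijective f hbij
  refine ⟨((MonoidHom.fst (Pin V) (Perm α)).comp K.subtype).comp e.symm.toMonoidHom, ?_⟩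
  ext1 σ
  obtain ⟨k, rfl⟩ := e.surjective σ
  obtain ⟨_, hk⟩ := hrho k k.2
  change rho V ((e.symm (e k) : K) : Pin V × Perm α).1 = π (e k)
  rw [MulEquiv.symm_apply_apply, hk]
  rfl

end Lifts

end PinLift

namespace PinLift

/-! ### From character congruences mod 8 to dimensions mod 4. -/

section Congruences

theorem modEq_eight_of_sub_eq {x y : ℝ} {m : ℕ} (r : ℕ) (h : x - y = 2 * m) :
    x - y ≡ (2 * r : ℝ) [PMOD (8 : ℝ)] ↔ m % 4 = r % 4 := by
  rw [h, AddCommGroup.modEq_iff_zsmul]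
  constructor
  · rintro ⟨z, hz⟩
    rw [zsmul_eq_mul] at hz
    have : (z * 8 : ℤ) = 2 * (r : ℤ) - 2 * m := by exact_mod_cast hz
    omega
  · intro h
    refine ⟨((r : ℤ) - m) / 4, ?_⟩
    obtain ⟨k, hk⟩ : (4 : ℤ) ∣ (r : ℤ) - m := by omega
    rw [hk, Int.mul_ediv_cancel_left _ (by norm_num), zsmul_eq_mul]
    have : (r : ℝ) - m = 4 * k := by exact_mod_cast hk
    linarith

theorem even_mul_succ_div_two_iff (m : ℕ) :
    Even (m * (m + 1) / 2) ↔ m % 4 = 0 ∨ m % 4 = 3 := by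
  obtain ⟨k, r, hr, rfl⟩ : ∃ k r, r < 4 ∧ m = 4 * k + r :=
    ⟨m / 4, m % 4, Nat.mod_lt _ (by norm_num), (Nat.div_add_mod m 4).symm⟩
  have h : (4 * k + r) * (4 * k + r + 1) = r * (r + 1) + 2 * (2 * (k * (4 * k + 2 * r + 1))) := by
    ring
  rw [h, Nat.add_mul_div_left _ _ two_pos, Nat.even_add]
  have h2 : Even (2 * (k * (4 * k + 2 * r + 1))) := even_two_mul _
  simp only [h2, iff_true]
  interval_cases r
  · simp
  · have : ¬ Even 1 := by decide
    simp [this]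
  · have : ¬ Even 3 := by decide
    simp [this]
  · have : Even 6 := by decide
    simp [this]

end Congruences

/-! ### The spinoriality criteria and the number of lifts. -/

section Main

open Equiv Equiv.Perm

variable {α : Type*} [Fintype α] [DecidableEq α]
  {V : Type*} [NormedAddCommGroup V] [InnerProductSpace ℝ V] [FiniteDimensional ℝ V]

/-- The square of a lift of `π g`, for an involution `g`, is governed by the character. -/
theorem exists_character_lift_sq {G : Type*} [Group G] (π : G →* (V ≃ₗᵢ[ℝ] V)) {g : G}
    (hg : g * g = 1) :
    ∃ m : ℕ, character π 1 - character π g = 2 * m ∧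
      LinearMap.det (π g).toLinearEquiv.toLinearMap = (-1) ^ m ∧
      ∀ x : Pin V, rho V x = π g → (x * x = 1 ↔ m % 4 = 0 ∨ m % 4 = 3) := by
  obtain ⟨m, htr, hdet, hsq⟩ :=
    exists_trace_det_lift_sq_of_involution (g := π g) (by rw [← map_mul, hg, map_one])
  refine ⟨m, ?_, hdet, fun x hx => ?_⟩
  · rw [← htr, character, character, map_one]
  · rw [hsq x hx, negOne_pow_eq_one_iff, even_mul_succ_div_two_iff]

/-- Whether the lifts of `π g` are involutions depends only on the conjugacy class of `g`. -/
theorem lift_sq_eq_one_of_conj {G : Type*} [Group G] (π : G →* (V ≃ₗᵢ[ℝ] V)) (g k : G)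
    (hg : ∀ x : Pin V, rho V x = π g → x * x = 1) (x : Pin V) (hx : rho V x = π (k * g * k⁻¹)) :
    x * x = 1 := by
  obtain ⟨y, hy⟩ := rho_surjective (π k)
  have h := hg (y⁻¹ * x * y) (by
    rw [map_mul, map_mul, map_inv, hx, hy, map_mul, map_mul, map_inv]
    group)
  have h2 : y⁻¹ * x * y * (y⁻¹ * x * y) = y⁻¹ * (x * x) * y := by group
  rw [h2, mul_eq_one_iff_eq_inv, mul_eq_left] at h
  exact h

/-- The spinoriality criterion for alternating groups, at any double transposition. -/
theorem alternatingGroup_isSpinorial_iff {x y z t : α} (hxyzt : [x, y, z, t].Nodup)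
    (hmem : swap x y * swap z t ∈ alternatingGroup α) (π : alternatingGroup α →* (V ≃ₗᵢ[ℝ] V)) :
    IsSpinorial π ↔
      character π 1 ≡ character π ⟨swap x y * swap z t, hmem⟩ [PMOD (8 : ℝ)] := by
  set g : alternatingGroup α := ⟨swap x y * swap z t, hmem⟩
  have hg : g * g = 1 := by
    apply Subtype.ext
    change swap x y * swap z t * (swap x y * swap z t) = 1
    nth_rewrite 1 [(disjoint_swap_swap hxyzt).commute.eq]
    rw [mul_assoc, swap_mul_self_mul, swap_mul_self]
  obtain ⟨m, hm, hdet, hsq⟩ := exists_character_lift_sq π hg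
  have hmod : character π 1 ≡ character π g [PMOD (8 : ℝ)] ↔ m % 4 = 0 := by
    have h := modEq_eight_of_sub_eq 0 hm
    rwa [Nat.cast_zero, mul_zero, AddCommGroup.sub_modEq_zero, Nat.zero_mod] at h
  -- Evenness rules out the residue `3`, leaving a single congruence.
  have heven : Even m := by
    rw [alternatingGroup_det_eq_one] at hdet
    by_contra hodd
    rw [Nat.not_even_iff_odd] at hodd
    rw [hodd.neg_one_pow] at hdet
    norm_num at hdet
  rw [hmod]
  constructor
  · rintro ⟨φ, hφ⟩
    have h1 := (hsq (φ g) (DFunLike.congr_fun hφ g)).mp (by rw [← map_mul, hg, map_one])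
    have h2 := Nat.even_iff.mp heven
    omega
  · intro hm0
    have hgsq : ∀ w : Pin V, rho V w = π g → w * w = 1 := fun w hw => (hsq w hw).mpr (Or.inl hm0)
    have hxz : x ≠ z := by grind
    refine isSpinorial_of_lift_sq_eq_one hxz π fun i j hi hj hij w hw => ?_
    have hnd : [x, i, z, j].Nodup := by grind
    obtain ⟨σ, hσ, hconj⟩ := exists_conj_swap_mul_swap hxyzt hnd
    refine lift_sq_eq_one_of_conj π g ⟨σ, hσ⟩ hgsq w (hw.trans ?_)
    congr 1
    apply Subtype.ext
    change swap x i * swap x z * (swap x j * swap x z) = σ * (swap x y * swap z t) * σ⁻¹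
    rw [hconj, swap_mul_swap_mul hj.1 hj.2]

/-- A lift on the alternating group and an involutive lift of a transposition extend to a lift on
the symmetric group. -/
theorem perm_exists_lift {a b : α} (hab : a ≠ b) (π : Perm α →* (V ≃ₗᵢ[ℝ] V))
    {φ : alternatingGroup α →* Pin V}
    (hφ : (rho V).comp φ = π.comp (alternatingGroup α).subtype) {c : Pin V}
    (hc : rho V c = π (swap a b)) (hcc : c * c = 1) :
    ∃ ψ : Perm α →* Pin V, (rho V).comp ψ = π ∧ ψ.comp (alternatingGroup α).subtype = φ ∧
      ψ (swap a b) = c := by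
  have hcinv : c⁻¹ = c := inv_eq_of_mul_eq_one_left hcc
  let θ : alternatingGroup α →* alternatingGroup α :=
    (MulAut.conjNormal (H := alternatingGroup α) (swap a b)).toMonoidHom
  -- Twisting `φ` by `c` and by the transposition gives another lift of the same restriction, so `φ'
  -- = φ` by uniqueness. This is the compatibility needed to extend.
  let φ' : alternatingGroup α →* Pin V := (MulAut.conj c).toMonoidHom.comp (φ.comp θ)
  have hφ' : (rho V).comp φ' = π.comp (alternatingGroup α).subtype := by
    ext1 h
    have h1 : rho V (φ (θ h)) = π (swap a b * (h : Perm α) * (swap a b)⁻¹) :=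
      DFunLike.congr_fun hφ (θ h)
    change rho V (c * φ (θ h) * c⁻¹) = π h
    rw [map_mul, map_mul, h1, map_inv, hc, ← map_inv, ← map_mul, ← map_mul, swap_inv]
    congr 1
    simp only [mul_assoc, swap_mul_self_mul, swap_mul_self, mul_one]
  have hconj : ∀ h : alternatingGroup α, c * φ h * c =
      φ ⟨swap a b * h * swap a b, swap_mul_mul_swap_mem_alternatingGroup a b h.2⟩ := by
    intro h
    have h1 := DFunLike.congr_fun (alternatingGroup_lift_unique hφ hφ')
      ⟨swap a b * h * swap a b, swap_mul_mul_swap_mem_alternatingGroup a b h.2⟩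
    rw [h1]
    change c * φ h * c = c * φ (θ _) * c⁻¹
    rw [hcinv]
    congr 3
    apply Subtype.ext
    change (h : Perm α) = swap a b * (swap a b * (h : Perm α) * swap a b) * (swap a b)⁻¹
    rw [swap_inv]
    simp only [mul_assoc, swap_mul_self_mul, swap_mul_self, mul_one]
  obtain ⟨ψ, hψ, hψs⟩ := exists_perm_hom_extending hab φ c hcc hconj
  refine ⟨ψ, perm_hom_ext hab ?_ ?_, hψ, hψs⟩
  · rw [MonoidHom.comp_assoc, hψ, hφ]
  · rw [MonoidHom.comp_apply, hψs, hc]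

/-- The restriction to the alternating group being unique, a lift is determined by its value at one
transposition. The two candidates differ by sign and have the same square, so both occur. -/
theorem perm_lifts_ncard {a b : α} (hab : a ≠ b) (π : Perm α →* (V ≃ₗᵢ[ℝ] V))
    (h : IsSpinorial π) : (lifts π).ncard = 2 := by
  obtain ⟨ψ, hψ⟩ := h
  have hss : ψ (swap a b) * ψ (swap a b) = 1 := by rw [← map_mul, swap_mul_self, map_one]
  have hrs : rho V (ψ (swap a b)) = π (swap a b) := DFunLike.congr_fun hψ _
  have hres : ∀ {χ : Perm α →* Pin V}, (rho V).comp χ = π →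
      (rho V).comp (χ.comp (alternatingGroup α).subtype) =
        π.comp (alternatingGroup α).subtype := by
    rintro χ rfl
    rfl
  obtain ⟨ψ', hψ', -, hs'⟩ := perm_exists_lift hab π (hres hψ)
    ((rho_negOne_mul (ψ (swap a b))).trans hrs)
    ((mul_self_eq_of_rho_eq (rho_negOne_mul _)).trans hss)
  rw [Set.ncard_eq_two]
  refine ⟨ψ, ψ', ?_, ?_⟩
  · rintro rfl
    exact negOne_ne_one (mul_eq_right.mp hs'.symm)
  · ext χ
    simp only [Set.mem_insert_iff, Set.mem_singleton_iff]
    constructor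
    · intro hχ
      have hχ : (rho V).comp χ = π := hχ
      have hχs : rho V (χ (swap a b)) = π (swap a b) := DFunLike.congr_fun hχ _
      rcases eq_or_eq_negOne_mul_of_rho_eq (hχs.trans hrs.symm) with h | h
      · exact Or.inl (perm_hom_ext hab (alternatingGroup_lift_unique (hres hχ) (hres hψ)) h)
      · exact Or.inr (perm_hom_ext hab (alternatingGroup_lift_unique (hres hχ) (hres hψ'))
          (h.trans hs'.symm))
    · rintro (rfl | rfl)
      · exact hψ
      · exact hψ'

/-- The spinoriality criterion for symmetric groups. -/
theorem perm_isSpinorial_iff {x y z t : α} (hxyzt : [x, y, z, t].Nodup)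
    (π : Perm α →* (V ≃ₗᵢ[ℝ] V)) :
    IsSpinorial π ↔
      character π 1 ≡ character π (swap x y * swap z t) [PMOD (8 : ℝ)] ∧
      (character π 1 - character π (swap x y) ≡ 0 [PMOD (8 : ℝ)] ∨
        character π 1 - character π (swap x y) ≡ 6 [PMOD (8 : ℝ)]) := by
  have hxy : x ≠ y := by grind
  have hzt : z ≠ t := by grind
  have hmem : swap x y * swap z t ∈ alternatingGroup α := by
    rw [mem_alternatingGroup, map_mul, sign_swap hxy, sign_swap hzt]
    simp
  obtain ⟨m, hm, -, hsq⟩ := exists_character_lift_sq π (swap_mul_self x y)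
  have h0 := modEq_eight_of_sub_eq 0 hm
  -- The residue `m ≡ 3` mod `4` becomes `2 · 3 = 6` mod `8`.
  have h6 := modEq_eight_of_sub_eq 3 hm
  norm_num at h0 h6
  rw [AddCommGroup.sub_modEq_zero, h0, h6]
  have hA : IsSpinorial (π.comp (alternatingGroup α).subtype) ↔
      character π 1 ≡ character π (swap x y * swap z t) [PMOD (8 : ℝ)] :=
    alternatingGroup_isSpinorial_iff hxyzt hmem (π.comp (alternatingGroup α).subtype)
  rw [← hA]
  constructor
  · rintro ⟨ψ, hψ⟩
    refine ⟨⟨ψ.comp (alternatingGroup α).subtype, by rw [← MonoidHom.comp_assoc, hψ]⟩, ?_⟩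
    refine (hsq (ψ (swap x y)) (DFunLike.congr_fun hψ _)).mp ?_
    rw [← map_mul, swap_mul_self, map_one]
  · rintro ⟨⟨φ, hφ⟩, h⟩
    obtain ⟨c, hc⟩ := rho_surjective (π (swap x y))
    obtain ⟨ψ, hψ, -, -⟩ := perm_exists_lift hxy π hφ hc ((hsq c hc).mpr h)
    exact ⟨ψ, hψ⟩

end Main

end PinLift

theorem theorem1p1 (n : ℕ) (hn : 4 ≤ n) (V : Type*) [NormedAddCommGroup V]
    [InnerProductSpace ℝ V] [FiniteDimensional ℝ V] :
    (∀ π : Equiv.Perm (Fin n) →* (V ≃ₗᵢ[ℝ] V),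
      (PinLift.IsSpinorial π ↔
        PinLift.character π 1 ≡ PinLift.character π (PinLift.s₁s₃ hn) [PMOD (8 : ℝ)] ∧
        (PinLift.character π 1 - PinLift.character π (PinLift.s₁ hn) ≡ 0 [PMOD (8 : ℝ)] ∨
          PinLift.character π 1 - PinLift.character π (PinLift.s₁ hn) ≡ 6 [PMOD (8 : ℝ)])) ∧
      (PinLift.IsSpinorial π → (PinLift.lifts π).ncard = 2)) ∧
    (∀ π : alternatingGroup (Fin n) →* (V ≃ₗᵢ[ℝ] V),
      (PinLift.IsSpinorial π ↔
        PinLift.character π 1 ≡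
          PinLift.character π ⟨PinLift.s₁s₃ hn, PinLift.s₁s₃_mem hn⟩ [PMOD (8 : ℝ)]) ∧
      (PinLift.IsSpinorial π →
        ∃! π' : alternatingGroup (Fin n) →* PinLift.Pin V, (PinLift.rho V).comp π' = π)) := by
  -- The letters keep the unreduced forms `1 - 1` and `3 - 1` to match the body of `s`.
  have hnodup : [(⟨1 - 1, by omega⟩ : Fin n), ⟨1, by omega⟩, ⟨3 - 1, by omega⟩,
      ⟨3, by omega⟩].Nodup := by
    simp [Fin.ext_iff]
  have hab : (⟨1 - 1, by omega⟩ : Fin n) ≠ ⟨1, by omega⟩ := by simp [Fin.ext_iff]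
  refine ⟨fun π => ⟨PinLift.perm_isSpinorial_iff hnodup π, PinLift.perm_lifts_ncard hab π⟩,
    fun π => ⟨PinLift.alternatingGroup_isSpinorial_iff hnodup (PinLift.s₁s₃_mem hn) π, ?_⟩⟩
  rintro ⟨φ, hφ⟩
  exact ⟨φ, hφ, fun ψ hψ => PinLift.alternatingGroup_lift_unique hψ hφ⟩
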